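/- Let $q\in\mathbb C$, $q\neq 0$, with $q^m\neq 1$ for all integers $m\ge 1$, let $c\in\mathbb C$ with $c^2\in\mathbb R\setminus\{0\}$, and let $N\ge 3$, $N=2n+\epsilon$ with $n\in\mathbb N$, $\epsilon\in\{0,1\}$. For $i\in\{1,\dots,N\}$ put $i'=N+1-i$, and let $\rho_i=N/2-i$ if $i<i'$, $\rho_i=-(N/2-i')$ if $i'<i$, and $\rho_i=0$ if $i=i'$. Put $$C^{ij}=C_{ij}=q^{-2\rho_i}\delta_{ij'},\qquad K^{ij}_{kl}=C^{ij}C_{kl},$$ $$\hat R^{ij}_{kl}=q^{2\delta_{ij}-2\delta_{ij'}}\delta_{il}\delta_{jk}+(q^2-q^{-2})\,\delta_{i<l}\,(\delta_{ik}\delta_{jl}-K^{ij}_{kl}),$$ where $\delta_{i<l}=1$ if $i<l$ and $\delta_{i<l}=0$ otherwise, and $$P_+=\frac1{q^2+q^{-2}}\Bigl(q^{-2}\,\mathrm{id}+\hat R-\frac{(q+q^{-1})(q-q^{-1})}{q^{2N}-1}K\Bigr).$$ The FRT-Clifford algebra $\mathrm{Cl}_q(N)$ (with parameter $c$) is the unital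 complex algebra generated by $\gamma_1,\dots,\gamma_N$ with the relations $$\sum_{k,l}(P_+)^{kl}_{ij}\,\gamma_k\gamma_l=0\quad(1\le i,j\le N),\qquad \sum_{i,j}C^{ij}\gamma_i\gamma_j=c^2\,\frac{q^{2N}-1}{q^2-1}.$$ Let $\nu\in\{1,-1\}$ if $N=2n+1$, and $\nu=1$ if $N=2n$. Set $$\varphi_N^\nu=(\nu c+\gamma_{n+1})\gamma_{n+2}\gamma_{n+3}\cdots\gamma_N\ \text{ if } N=2n+1,\qquad \varphi_N^1=\gamma_{n+1}\gamma_{n+2}\cdots\gamma_N\ \text{ if } N=2n.$$ **Proposition.** The left ideal $\mathrm{Cl}_q(N)\,\varphi_N^\nu$ of $\mathrm{Cl}_q(N)$ is minimal (it is nonzero and contains no left ideals other than $0$ and itself). The elements $\gamma_1^{i_1}\gamma_2^{i_2}\cdots\gamma_n^{i_n}\varphi_N^\nu$ with $i_1,\dots,i_n\in\{0,1\}$ are pairwise distinct and form a complex vector space basis of it; hence its dimension is $2^n$. -/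

import Mathlib

noncomputable section

namespace FRTClifford

/-! The index `i : Fin N` stands for the label `i + 1` in `{1, …, N}`, so the label `i' = N + 1 - i`
is `Fin.rev i`. -/

/-- The integer `2 ρ_i`, where `ρ_i = N/2 - i` if `i < i'`, `ρ_i = -(N/2 - i')` if `i' < i`, and
`ρ_i = 0` if `i = i'` (in labels `1, …, N`). -/
def twoRho {N : ℕ} (i : Fin N) : ℤ :=
  if i < i.rev then (N : ℤ) - 2 * ((i : ℤ) + 1)
  else if i.rev < i then -((N : ℤ) - 2 * ((i.rev : ℤ) + 1))
  else 0

/-- Kronecker's symbol. -/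
def delta {N : ℕ} (i j : Fin N) : ℂ := if i = j then 1 else 0

/-- The metric `C^{ij} = C_{ij} = q^{-2 ρ_i} δ^i_{j'}`. -/
def metric (q : ℂ) {N : ℕ} (i j : Fin N) : ℂ := q ^ (-twoRho i) * delta i j.rev

/-- `K^{ij}_{kl} = C^{ij} C_{kl}`. -/
def K (q : ℂ) {N : ℕ} (i j k l : Fin N) : ℂ := metric q i j * metric q k l

/-- The matrix `R̂^{ij}_{kl}` of the orthogonal quantum group `O_q(N)`. -/
def Rhat (q : ℂ) {N : ℕ} (i j k l : Fin N) : ℂ :=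
  q ^ ((if i = j then 2 else 0) - (if i = j.rev then 2 else 0) : ℤ) * delta i l * delta j k
    + (q ^ 2 - (q ^ 2)⁻¹) * (if i < l then 1 else 0) * (delta i k * delta j l - K q i j k l)

/-- The `q`-symmetrizing projection
`P₊ = (q² + q⁻²)⁻¹ (q⁻² id + R̂ - (q + q⁻¹)(q - q⁻¹) / (q^{2N} - 1) K)`, entry `^{ij}_{kl}`. -/
def Pplus (q : ℂ) {N : ℕ} (i j k l : Fin N) : ℂ :=
  (q ^ 2 + (q ^ 2)⁻¹)⁻¹ *
    ((q ^ 2)⁻¹ * (delta i k * delta j l) + Rhat q i j k l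
      - (q + q⁻¹) * (q - q⁻¹) / (q ^ (2 * N) - 1) * K q i j k l)

/-- The defining relations of the FRT-Clifford algebra on the free algebra in `γ_1, …, γ_N`:
`∑ P₊^{kl}_{ij} γ_k γ_l = 0` for all `i, j`, and `∑ C^{ij} γ_i γ_j = c² (q^{2N} - 1)/(q² - 1)`. -/
inductive Rel (q c : ℂ) (N : ℕ) : FreeAlgebra ℂ (Fin N) → FreeAlgebra ℂ (Fin N) → Prop
  | symm (i j : Fin N) :
      Rel q c N (∑ k : Fin N, ∑ l : Fin N,
        Pplus q k l i j • (FreeAlgebra.ι ℂ k * FreeAlgebra.ι ℂ l)) 0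
  | metric :
      Rel q c N (∑ i : Fin N, ∑ j : Fin N,
        metric q i j • (FreeAlgebra.ι ℂ i * FreeAlgebra.ι ℂ j))
        (algebraMap ℂ _ (c ^ 2 * ((q ^ (2 * N) - 1) / (q ^ 2 - 1))))

/-- The FRT-Clifford algebra `Cl_q(N)` with parameter `c`. -/
def Cl (q c : ℂ) (N : ℕ) : Type := RingQuot (Rel q c N)

instance (q c : ℂ) (N : ℕ) : Ring (Cl q c N) := inferInstanceAs (Ring (RingQuot (Rel q c N)))

instance (q c : ℂ) (N : ℕ) : Algebra ℂ (Cl q c N) :=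
  inferInstanceAs (Algebra ℂ (RingQuot (Rel q c N)))

/-- The generator of `Cl_q(N)` with label `i + 1`. -/
def γ (q c : ℂ) {N : ℕ} (i : Fin N) : Cl q c N :=
  RingQuot.mkAlgHom ℂ (Rel q c N) (FreeAlgebra.ι ℂ i)

/-- `φ = γ_{n+1} γ_{n+2} ⋯ γ_{2n}` in `Cl_q(2n)`. -/
def phiEven (q c : ℂ) (n : ℕ) : Cl q c (2 * n) :=
  (List.ofFn fun k : Fin n => γ q c (⟨n + k, by omega⟩ : Fin (2 * n))).prod

/-- `φ^ν = (ν c + γ_{n+1}) γ_{n+2} ⋯ γ_{2n+1}` in `Cl_q(2n+1)`. -/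
def phiOdd (q c : ℂ) (n : ℕ) (ν : ℂ) : Cl q c (2 * n + 1) :=
  (algebraMap ℂ _ (ν * c) + γ q c (⟨n, by omega⟩ : Fin (2 * n + 1))) *
    (List.ofFn fun k : Fin n => γ q c (⟨n + 1 + k, by omega⟩ : Fin (2 * n + 1))).prod

/-- The ordered monomial `γ_1^{i_1} γ_2^{i_2} ⋯ γ_n^{i_n}` in `Cl_q(N)`, for `n ≤ N`. -/
def monomial (q c : ℂ) {n N : ℕ} (h : n ≤ N) (i : Fin n → Fin 2) : Cl q c N :=
  (List.ofFn fun k : Fin n => γ q c (Fin.castLE h k) ^ (i k : ℕ)).prod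

/-- The left ideal `Cl_q(N) φ`. (`Ideal` means left ideal in a noncommutative ring.) -/
def leftIdeal {q c : ℂ} {N : ℕ} (φ : Cl q c N) : Ideal (Cl q c N) := Ideal.span {φ}

theorem mem_leftIdeal {q c : ℂ} {N : ℕ} {φ x : Cl q c N} :
    x ∈ leftIdeal φ ↔ ∃ a, a * φ = x := Ideal.mem_span_singleton'

end FRTClifford

end

noncomputable section

namespace FRTClifford

/-! The algebra behaves like a fermionic system with `n` modes: for `k ≤ n` the generator `γ_k`
creates in mode `k`, `γ_{k'}` annihilates, and for odd `N` the middle generator is diagonal.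
Contracting `P₊` turns the relations into q-anticommutation rules (`CliffordRel`) in which conjugate
generators anticommute up to partial sums of the quadratic form.

The element `φ` is a vacuum: it is killed by every annihilator and is an eigenvector, with
eigenvalue `ν c`, of the middle generator. These facts alone determine how each generator acts on an
ordered monomial times `φ`. Hence the linear map `fromFock` from the Fock space of functions on
`{0,1}^n` intertwines explicit ladder operators with left multiplication (`fromFock_fockGen`), and
its image is the left ideal of `φ` (`mem_leftIdeal_iff_mem_range`).

Annihilators bring any nonzero Fock vector to the vacuum (`single_zero_mem`), so a left ideal
containing the image of one contains `φ`. For the zero ideal this gives injectivity, hence the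
basis; for a nonzero subideal it gives minimality.

What remains is `φ ≠ 0`. For this the Fock operators are checked to satisfy the relations
(`cliffordRel_fockGen`), so that the algebra acts on Fock space, where `φ` is a nonzero operator. -/

/-- The partial sum `∑_{k < a} C^{kk'} X_k X_{k'}` of the quadratic form. -/
def partialForm {A : Type*} [Ring A] [Algebra ℂ A] (q : ℂ) {N : ℕ} (X : Fin N → A) (a : ℕ) : A :=
  ∑ k : Fin N, if (k : ℕ) < a then q ^ (-twoRho k) • (X k * X k.rev) else 0

/-- The defining relations of `Cl_q(N)`, contracted and expressed through `partialForm`. -/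
structure CliffordRel {A : Type*} [Ring A] [Algebra ℂ A] (q c : ℂ) {N : ℕ} (X : Fin N → A) :
    Prop where
  total : partialForm q X N = (c ^ 2 * ((q ^ (2 * N) - 1) / (q ^ 2 - 1))) • (1 : A)
  exchange (i j : Fin N) :
    (q ^ 2)⁻¹ • (X i * X j)
      + q ^ ((if i = j then 2 else 0) - (if i = j.rev then 2 else 0) : ℤ) • (X j * X i)
      + (if i < j then (q ^ 2 - (q ^ 2)⁻¹) • (X i * X j) else 0)
      = metric q i j • ((q ^ 2 - (q ^ 2)⁻¹) • partialForm q X j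
          + (c ^ 2 * (1 + (q ^ 2)⁻¹)) • (1 : A))

/-! ### Contracting the defining relations -/

section Contraction

variable {A : Type*} [Ring A] [Algebra ℂ A] {N : ℕ}

theorem sum_delta_delta (Y : Fin N → Fin N → A) (i j : Fin N) :
    ∑ k, ∑ l, (delta k i * delta l j) • Y k l = Y i j := by
  simp [delta, ite_smul]

theorem sum_metric_smul (q : ℂ) (X : Fin N → A) :
    ∑ k, ∑ l, metric q k l • (X k * X l) = partialForm q X N := by
  unfold partialForm metric delta
  refine Finset.sum_congr rfl fun k _ => ?_
  rw [Finset.sum_eq_single k.rev]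
  · simp
  · intro l _ hl
    rw [if_neg, mul_zero, zero_smul]
    rintro rfl
    simp at hl
  · simp

theorem sum_metric_smul_lt (q : ℂ) (X : Fin N → A) (j : Fin N) :
    ∑ k, ∑ l, ((if k < j then 1 else 0 : ℂ) * metric q k l) • (X k * X l)
      = partialForm q X j := by
  unfold partialForm metric delta
  refine Finset.sum_congr rfl fun k _ => ?_
  rw [Finset.sum_eq_single k.rev]
  · by_cases h : k < j
    · simp [h]
    · simp [h]
  · intro l _ hl
    rw [if_neg (c := k = l.rev), mul_zero, mul_zero, zero_smul]
    rintro rfl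
    simp at hl
  · simp

/-- The step function in `Rhat` compares the first upper index `k` with the last lower index `j`. On
the identity part `k = i`, so it becomes `i < j`; on the `K` part it truncates the quadratic form at
`k < j`, which is where partial sums enter. -/
theorem sum_Pplus_smul (q : ℂ) (X : Fin N → A) (i j : Fin N) :
    ∑ k, ∑ l, Pplus q k l i j • (X k * X l)
      = (q ^ 2 + (q ^ 2)⁻¹)⁻¹ • ((q ^ 2)⁻¹ • (X i * X j)
        + q ^ ((if i = j then 2 else 0) - (if i = j.rev then 2 else 0) : ℤ) • (X j * X i)
        + (if i < j then (q ^ 2 - (q ^ 2)⁻¹) • (X i * X j) else 0)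
        - metric q i j • ((q ^ 2 - (q ^ 2)⁻¹) • partialForm q X j
          + ((q + q⁻¹) * (q - q⁻¹) / (q ^ (2 * N) - 1)) • partialForm q X N)) := by
  have key : ∀ k l, Pplus q k l i j • (X k * X l)
      = (q ^ 2 + (q ^ 2)⁻¹)⁻¹ • ((q ^ 2)⁻¹ • ((delta k i * delta l j) • (X k * X l))
        + q ^ ((if i = j then 2 else 0) - (if i = j.rev then 2 else 0) : ℤ) •
            ((delta k j * delta l i) • (X k * X l))
        + (if i < j then q ^ 2 - (q ^ 2)⁻¹ else 0) • ((delta k i * delta l j) • (X k * X l))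
        - metric q i j • ((q ^ 2 - (q ^ 2)⁻¹) •
              (((if k < j then 1 else 0 : ℂ) * metric q k l) • (X k * X l))
          + ((q + q⁻¹) * (q - q⁻¹) / (q ^ (2 * N) - 1)) • (metric q k l • (X k * X l)))) := by
    intro k l
    simp only [smul_smul, ← add_smul, ← sub_smul]
    congr 1
    have e1 : q ^ ((if k = l then 2 else 0) - (if k = l.rev then 2 else 0) : ℤ) * delta k j
          * delta l i
        = q ^ ((if i = j then 2 else 0) - (if i = j.rev then 2 else 0) : ℤ) *
            (delta k j * delta l i) := by
      unfold delta
      by_cases h1 : k = j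
      · by_cases h2 : l = i
        · subst h1 h2
          simp [eq_comm (a := l) (b := k), Fin.rev_eq_iff, eq_comm (a := k) (b := l.rev)]
        · simp [h2]
      · simp [h1]
    have e2 : (if k < j then 1 else 0 : ℂ) * (delta k i * delta l j)
        = (if i < j then 1 else 0) * (delta k i * delta l j) := by
      unfold delta
      split_ifs <;> simp_all
    have e3 : (if i < j then q ^ 2 - (q ^ 2)⁻¹ else 0)
        = (q ^ 2 - (q ^ 2)⁻¹) * (if i < j then 1 else 0) := by simp
    unfold Pplus Rhat K
    rw [e3]
    linear_combination (q ^ 2 + (q ^ 2)⁻¹)⁻¹ * e1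
      + (q ^ 2 + (q ^ 2)⁻¹)⁻¹ * (q ^ 2 - (q ^ 2)⁻¹) * e2
  simp only [key, ← Finset.smul_sum, Finset.sum_add_distrib, Finset.sum_sub_distrib,
    sum_delta_delta, sum_metric_smul, sum_metric_smul_lt]
  split_ifs <;> simp

theorem sq_add_inv_ne_zero {q : ℂ} (hq0 : q ≠ 0) (hq : ∀ m : ℕ, 0 < m → q ^ m ≠ 1) :
     q ^ 2 + (q ^ 2)⁻¹ ≠ 0 := by
  intro h
  have h4 : q ^ 4 = -1 := by
    field_simp at h
    linear_combination h
  apply hq 8 (by norm_num)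
  linear_combination (q ^ 4 - 1) * h4

theorem cliffordRel_iff {q c : ℂ} (hq0 : q ≠ 0) (hq : ∀ m : ℕ, 0 < m → q ^ m ≠ 1)
    (hN : 0 < N) (X : Fin N → A) :
    CliffordRel q c X ↔
      (∀ i j, ∑ k, ∑ l, Pplus q k l i j • (X k * X l) = 0) ∧
        ∑ i, ∑ j, metric q i j • (X i * X j)
          = algebraMap ℂ A (c ^ 2 * ((q ^ (2 * N) - 1) / (q ^ 2 - 1))) := by
  have h1 : q ^ (2 * N) - 1 ≠ 0 := sub_ne_zero.2 (hq _ (by omega))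
  have h2 : q ^ 2 - 1 ≠ 0 := sub_ne_zero.2 (hq _ (by omega))
  -- The factor `q^{2N} - 1` cancels against the prescribed value of the full form, leaving the
  -- constant of `exchange`.
  have hmu : (q + q⁻¹) * (q - q⁻¹) / (q ^ (2 * N) - 1)
      * (c ^ 2 * ((q ^ (2 * N) - 1) / (q ^ 2 - 1))) = c ^ 2 * (1 + (q ^ 2)⁻¹) := by
    field_simp
  rw [sum_metric_smul, Algebra.algebraMap_eq_smul_one]
  constructor
  · intro h
    refine ⟨fun i j => ?_, h.total⟩
    rw [sum_Pplus_smul, h.exchange i j, h.total, smul_smul _ _ (1 : A), hmu, sub_self, smul_zero]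
  · rintro ⟨hs, ht⟩
    refine ⟨ht, fun i j => ?_⟩
    have h := hs i j
    rw [sum_Pplus_smul, smul_eq_zero_iff_right (inv_ne_zero (sq_add_inv_ne_zero hq0 hq)),
      ht, smul_smul _ _ (1 : A), hmu, sub_eq_zero] at h
    exact h

theorem cliffordRel_γ {q c : ℂ} (hq0 : q ≠ 0) (hq : ∀ m : ℕ, 0 < m → q ^ m ≠ 1)
    (hN : 0 < N) : CliffordRel q c (γ q c : Fin N → Cl q c N) := by
  rw [cliffordRel_iff hq0 hq hN]
  constructor
  · intro i j
    have := RingQuot.mkAlgHom_rel ℂ (Rel.symm (q := q) (c := c) i j)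
    rw [map_zero] at this
    refine Eq.trans ?_ this
    simp only [map_sum, map_smul, map_mul]
    rfl
  · have := RingQuot.mkAlgHom_rel ℂ (Rel.metric (q := q) (c := c) (N := N))
    rw [AlgHom.commutes] at this
    refine Eq.trans ?_ this
    simp only [map_sum, map_smul, map_mul]
    rfl

theorem exists_algHom {q c : ℂ} (hq0 : q ≠ 0) (hq : ∀ m : ℕ, 0 < m → q ^ m ≠ 1)
    (hN : 0 < N) {X : Fin N → A} (hX : CliffordRel q c X) :
    ∃ F : Cl q c N →ₐ[ℂ] A, ∀ i, F (γ q c i) = X i := by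
  rw [cliffordRel_iff hq0 hq hN] at hX
  refine ⟨RingQuot.liftAlgHom ℂ ⟨FreeAlgebra.lift ℂ X, ?_⟩, fun i => ?_⟩
  · rintro _ _ (⟨i, j⟩ | _)
    · simpa using hX.1 i j
    · simpa using hX.2
  · have := RingQuot.liftAlgHom_mkAlgHom_apply ℂ (FreeAlgebra.lift ℂ X) (s := Rel q c N)
      (by
        rintro _ _ (⟨i, j⟩ | _)
        · simpa using hX.1 i j
        · simpa using hX.2) (FreeAlgebra.ι ℂ i)
    rw [FreeAlgebra.lift_ι_apply] at this
    exact this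

end Contraction

/-! ### The Fock space representation -/

section Fock

variable {n N : ℕ}

/-- The weight `∏_{k < a} (-q²)^{i_k}` of an occupation vector `i`. -/
def signWeight (q : ℂ) (a : ℕ) (i : Fin n → Fin 2) : ℂ :=
  ∏ k : Fin n, if (k : ℕ) < a then (-q ^ 2) ^ (i k : ℕ) else 1

theorem signWeight_ne_zero {q : ℂ} (hq0 : q ≠ 0) (a : ℕ) (i : Fin n → Fin 2) :
    signWeight q a i ≠ 0 := by
  refine Finset.prod_ne_zero_iff.2 fun k _ => ?_
  split_ifs
  · exact pow_ne_zero _ (neg_ne_zero.2 (pow_ne_zero _ hq0))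
  · exact one_ne_zero

theorem signWeight_zero (q : ℂ) (i : Fin n → Fin 2) : signWeight q 0 i = 1 := by
  simp [signWeight]

theorem signWeight_succ (q : ℂ) (k : Fin n) (i : Fin n → Fin 2) :
    signWeight q (k + 1) i = (-q ^ 2) ^ (i k : ℕ) * signWeight q k i := by
  unfold signWeight
  rw [← Finset.mul_prod_erase _ _ (Finset.mem_univ k),
    ← Finset.mul_prod_erase _ (fun l : Fin n => if (l : ℕ) < k then _ else _)
      (Finset.mem_univ k)]
  simp only [lt_irrefl, if_false, one_mul, Nat.lt_succ_self, if_true]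
  congr 1
  refine Finset.prod_congr rfl fun l hl => ?_
  have : (l : ℕ) ≠ k := fun h => (Finset.ne_of_mem_erase hl) (Fin.ext h)
  have h2 : (l : ℕ) < k + 1 ↔ (l : ℕ) < k := by omega
  simp only [h2]

theorem signWeight_update_of_le (q : ℂ) {a : ℕ} {k : Fin n} (h : a ≤ k) (i : Fin n → Fin 2)
    (b : Fin 2) : signWeight q a (Function.update i k b) = signWeight q a i := by
  refine Finset.prod_congr rfl fun l _ => ?_
  split_ifs with hl
  · rw [Function.update_of_ne]
    rintro rfl
    omega
  · rfl

theorem signWeight_update_of_lt (q : ℂ) {a : ℕ} {k : Fin n} (h : (k : ℕ) < a)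
    (i : Fin n → Fin 2) (b : Fin 2) :
    (-q ^ 2) ^ (i k : ℕ) * signWeight q a (Function.update i k b)
      = (-q ^ 2) ^ (b : ℕ) * signWeight q a i := by
  unfold signWeight
  rw [← Finset.mul_prod_erase _ _ (Finset.mem_univ k),
    ← Finset.mul_prod_erase _ (fun l : Fin n => if (l : ℕ) < a then (-q ^ 2) ^ (i l : ℕ) else 1)
      (Finset.mem_univ k)]
  rw [if_pos h, if_pos h, Function.update_self, mul_left_comm]
  congr 2
  refine Finset.prod_congr rfl fun l hl => ?_
  rw [Function.update_of_ne (Finset.ne_of_mem_erase hl)]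

theorem signWeight_update_zero (q : ℂ) {a : ℕ} {k : Fin n} (h : (k : ℕ) < a)
    {i : Fin n → Fin 2} (hi : i k = 1) :
    signWeight q a i = -q ^ 2 * signWeight q a (Function.update i k 0) := by
  have := signWeight_update_of_lt q h i 0
  rw [hi] at this
  simpa using this.symm

theorem signWeight_update_one (q : ℂ) {a : ℕ} {k : Fin n} (h : (k : ℕ) < a)
    {i : Fin n → Fin 2} (hi : i k = 0) :
    signWeight q a (Function.update i k 1) = -q ^ 2 * signWeight q a i := by
  have := signWeight_update_of_lt q h i 1
  rw [hi] at this
  simpa using this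

/-- The operator on Fock space that changes the occupation of the `j`-th mode to `b`. -/
def ladder (q : ℂ) (j : Fin n) (b : Fin 2) : Module.End ℂ ((Fin n → Fin 2) → ℂ) where
  toFun f i := if i j = b then signWeight q j i * f (Function.update i j (b + 1)) else 0
  map_add' f g := by
    funext i
    simp only [Pi.add_apply]
    split_ifs <;> ring
  map_smul' r f := by
    funext i
    simp only [Pi.smul_apply, smul_eq_mul, RingHom.id_apply]
    split_ifs <;> ring

theorem ladder_apply (q : ℂ) (j : Fin n) (b : Fin 2) (f : (Fin n → Fin 2) → ℂ)
    (i : Fin n → Fin 2) : ladder q j b f i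
      = if i j = b then signWeight q j i * f (Function.update i j (b + 1)) else 0 := rfl

/-- The diagonal operator with eigenvalues `w`. -/
def diagOp (w : (Fin n → Fin 2) → ℂ) : Module.End ℂ ((Fin n → Fin 2) → ℂ) where
  toFun f i := w i * f i
  map_add' f g := by
    funext i
    simp only [Pi.add_apply]
    ring
  map_smul' r f := by
    funext i
    simp only [Pi.smul_apply, smul_eq_mul, RingHom.id_apply]
    ring

theorem diagOp_apply (w : (Fin n → Fin 2) → ℂ) (f : (Fin n → Fin 2) → ℂ) (i : Fin n → Fin 2) :
    diagOp w f i = w i * f i := rfl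

theorem fin_two_add_one_add_one (b : Fin 2) : b + 1 + 1 = b := by decide +revert

theorem ladder_mul_self (q : ℂ) (j : Fin n) (b : Fin 2) : ladder q j b * ladder q j b = 0 := by
  refine LinearMap.ext fun f => funext fun i => ?_
  simp [Module.End.mul_apply, ladder_apply]

theorem ladder_mul_ladder_apply (q : ℂ) (j : Fin n) (b : Fin 2) (f : (Fin n → Fin 2) → ℂ)
    (i : Fin n → Fin 2) :
    (ladder q j b * ladder q j (b + 1)) f i
      = if i j = b then signWeight q j i ^ 2 * f i else 0 := by
  simp only [Module.End.mul_apply, ladder_apply, Function.update_self, Function.update_idem,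
    fin_two_add_one_add_one, signWeight_update_of_le q le_rfl, if_true]
  split_ifs with h
  · rw [← h, Function.update_eq_self]
    ring
  · rfl

/-- A q-deformed Jordan–Wigner sign: the weight attached to mode `k` sees the occupation of the
earlier mode `j`, while the weight of `j` does not see `k`. Filling `j` therefore costs one factor
`-q²`. -/
theorem ladder_mul_ladder_one (q : ℂ) {j k : Fin n} (h : j < k) (b : Fin 2) :
    ladder q k b * ladder q j 1 = (-q ^ 2) • (ladder q j 1 * ladder q k b) := by
  refine LinearMap.ext fun f => funext fun i => ?_
  simp only [Module.End.mul_apply, LinearMap.smul_apply, Pi.smul_apply, smul_eq_mul, ladder_apply,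
    Function.update_of_ne h.ne, Function.update_of_ne h.ne',
    signWeight_update_of_le q (show (j : ℕ) ≤ k from h.le)]
  rw [Function.update_comm h.ne]
  by_cases hj : i j = 1
  · by_cases hk : i k = b
    · rw [if_pos hk, if_pos hj, if_pos hj, if_pos hk, signWeight_update_zero q h hj]
      norm_num [show (1 + 1 : Fin 2) = 0 from rfl]
      ring
    · simp [hk]
  · simp [hj]

theorem ladder_zero_mul_ladder (q : ℂ) {j k : Fin n} (h : j < k) (b : Fin 2) :
    ladder q j 0 * ladder q k b = (-q ^ 2) • (ladder q k b * ladder q j 0) := by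
  refine LinearMap.ext fun f => funext fun i => ?_
  simp only [Module.End.mul_apply, LinearMap.smul_apply, Pi.smul_apply, smul_eq_mul, ladder_apply,
    Function.update_of_ne h.ne, Function.update_of_ne h.ne',
    signWeight_update_of_le q (show (j : ℕ) ≤ k from h.le)]
  rw [Function.update_comm h.ne]
  by_cases hj : i j = 0
  · by_cases hk : i k = b
    · rw [if_pos hk, if_pos hj, if_pos hj, if_pos hk, zero_add, signWeight_update_one q h hj]
      ring
    · simp [hk]
  · simp [hj]

/-- The full weight behaves like that of a mode placed after all the others. -/
theorem diagOp_mul_ladder_one (q r : ℂ) (j : Fin n) :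
    diagOp (fun i => r * signWeight q n i) * ladder q j 1
      = (-q ^ 2) • (ladder q j 1 * diagOp (fun i => r * signWeight q n i)) := by
  refine LinearMap.ext fun f => funext fun i => ?_
  simp only [Module.End.mul_apply, LinearMap.smul_apply, Pi.smul_apply, smul_eq_mul, ladder_apply,
    diagOp_apply]
  by_cases hj : i j = 1
  · rw [if_pos hj, if_pos hj, signWeight_update_zero q j.2 hj, show (1 + 1 : Fin 2) = 0 from rfl]
    ring
  · simp [hj]

theorem ladder_zero_mul_diagOp (q r : ℂ) (j : Fin n) :
    ladder q j 0 * diagOp (fun i => r * signWeight q n i)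
      = (-q ^ 2) • (diagOp (fun i => r * signWeight q n i) * ladder q j 0) := by
  refine LinearMap.ext fun f => funext fun i => ?_
  simp only [Module.End.mul_apply, LinearMap.smul_apply, Pi.smul_apply, smul_eq_mul, ladder_apply,
    diagOp_apply]
  by_cases hj : i j = 0
  · rw [if_pos hj, if_pos hj, zero_add, signWeight_update_one q j.2 hj]
    ring
  · simp [hj]

/-! ### Indices -/

theorem index_cases (h2 : 2 * n ≤ N) (h3 : N ≤ 2 * n + 1) (a : Fin N) :
    (∃ k : Fin n, a = Fin.castLE (by omega) k) ∨ (∃ k : Fin n, a = (Fin.castLE (by omega) k).rev) ∨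
      (N = 2 * n + 1 ∧ (a : ℕ) = n) := by
  have ha := a.2
  rcases lt_or_ge (a : ℕ) n with h | h
  · exact Or.inl ⟨⟨a, h⟩, rfl⟩
  · rcases lt_or_ge (a.rev : ℕ) n with h' | h'
    · exact Or.inr (Or.inl ⟨⟨a.rev, h'⟩, Fin.rev_eq_iff.1 rfl⟩)
    · rw [Fin.val_rev] at h'
      exact Or.inr (Or.inr (by omega))

theorem rev_eq_self_of_val {a : Fin N} (hN : N = 2 * n + 1) (ha : (a : ℕ) = n) : a.rev = a := by
  ext
  rw [Fin.val_rev]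
  omega

theorem twoRho_rev (a : Fin N) : twoRho a.rev = -twoRho a := by
  unfold twoRho
  rw [Fin.rev_rev]
  rcases lt_trichotomy a a.rev with h | h | h
  · rw [if_neg h.not_gt, if_pos h, if_pos h]
  · rw [← h]
    simp
  · rw [if_pos h, if_neg h.not_gt, if_pos h]
    ring

theorem twoRho_castLE (h2 : 2 * n ≤ N) (k : Fin n) :
    twoRho (Fin.castLE (by omega) k : Fin N) = ((N - 2 * k - 2 : ℕ) : ℤ) := by
  have hk := k.2
  unfold twoRho
  rw [if_pos]
  · rw [Fin.val_castLE]
    omega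
  · rw [Fin.lt_def, Fin.val_rev, Fin.val_castLE]
    omega

theorem twoRho_of_rev_eq {a : Fin N} (h : a.rev = a) : twoRho a = 0 := by
  simp [twoRho, h]

/-! ### The generators on Fock space -/

/-- The action of the generator with index `a` on Fock space. -/
def fockGen (q c ν : ℂ) (n : ℕ) (a : Fin N) : Module.End ℂ ((Fin n → Fin 2) → ℂ) :=
  if h : (a : ℕ) < n then ladder q ⟨a, h⟩ 1
  else if h : (a.rev : ℕ) < n then
    (c ^ 2 * (1 + q ^ 2) * q ^ twoRho a.rev) • ladder q ⟨a.rev, h⟩ 0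
  else diagOp fun i => ν * c * signWeight q n i

variable (q c ν : ℂ)

theorem fockGen_castLE (h : n ≤ N) (k : Fin n) :
    fockGen q c ν n (Fin.castLE h k : Fin N) = ladder q k 1 := by
  unfold fockGen
  rw [dif_pos (show ((Fin.castLE h k : Fin N) : ℕ) < n from k.2)]
  rfl

theorem fockGen_rev_castLE (h2 : 2 * n ≤ N) (k : Fin n) :
    fockGen q c ν n (Fin.castLE (by omega) k : Fin N).rev
      = (c ^ 2 * (1 + q ^ 2) * q ^ (N - 2 * k - 2)) • ladder q k 0 := by
  have hk := k.2
  unfold fockGen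
  have h1 : ¬ (((Fin.castLE (by omega) k : Fin N).rev : Fin N) : ℕ) < n := by
    rw [Fin.val_rev, Fin.val_castLE]
    omega
  rw [dif_neg h1]
  simp only [Fin.rev_rev]
  rw [dif_pos (show ((Fin.castLE (by omega) k : Fin N) : ℕ) < n from k.2), twoRho_castLE h2,
    zpow_natCast]
  rfl

theorem fockGen_middle {a : Fin N} (hN : N = 2 * n + 1) (ha : (a : ℕ) = n) :
    fockGen q c ν n a = diagOp fun i => ν * c * signWeight q n i := by
  unfold fockGen
  rw [dif_neg (by omega), dif_neg]
  rw [rev_eq_self_of_val hN ha]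
  omega

theorem fockGen_exchange (h2 : 2 * n ≤ N) (h3 : N ≤ 2 * n + 1) {a b : Fin N} (hab : a < b)
    (hr : b ≠ a.rev) : fockGen q c ν n b * fockGen q c ν n a
      = (-q ^ 2) • (fockGen q c ν n a * fockGen q c ν n b) := by
  rw [Fin.lt_def] at hab
  rcases index_cases h2 h3 a with ⟨k, rfl⟩ | ⟨k, rfl⟩ | ⟨hN, ha⟩ <;>
  rcases index_cases h2 h3 b with ⟨l, rfl⟩ | ⟨l, rfl⟩ | ⟨hN', hb⟩ <;>
  try simp only [Fin.val_rev, Fin.val_castLE] at hab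
  · rw [fockGen_castLE, fockGen_castLE, ladder_mul_ladder_one q hab]
  · have hkl : l ≠ k := by
      rintro rfl
      exact hr rfl
    rw [fockGen_castLE, fockGen_rev_castLE q c ν h2]
    rcases lt_or_gt_of_ne hkl with h | h
    · rw [smul_mul_assoc, ladder_zero_mul_ladder q h, mul_smul_comm, smul_comm]
    · rw [smul_mul_assoc, ladder_mul_ladder_one q h, mul_smul_comm, smul_comm]
  · rw [fockGen_castLE, fockGen_middle q c ν hN' hb, diagOp_mul_ladder_one]
  · omega
  · have h : l < k := by
      rw [Fin.lt_def]
      omega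
    rw [fockGen_rev_castLE q c ν h2, fockGen_rev_castLE q c ν h2]
    simp only [smul_mul_assoc, mul_smul_comm]
    rw [ladder_zero_mul_ladder q h]
    simp only [smul_smul]
    congr 1
    ring
  · omega
  · omega
  · rw [fockGen_rev_castLE q c ν h2, fockGen_middle q c ν hN ha, smul_mul_assoc,
      ladder_zero_mul_diagOp, mul_smul_comm, smul_comm]
  · omega

theorem fockGen_mul_self (h2 : 2 * n ≤ N) (h3 : N ≤ 2 * n + 1) {a : Fin N}
    (hr : a ≠ a.rev) : fockGen q c ν n a * fockGen q c ν n a = 0 := by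
  rcases index_cases h2 h3 a with ⟨k, rfl⟩ | ⟨k, rfl⟩ | ⟨hN, ha⟩
  · rw [fockGen_castLE, ladder_mul_self]
  · rw [fockGen_rev_castLE q c ν h2, smul_mul_assoc, mul_smul_comm, ladder_mul_self, smul_zero,
      smul_zero]
  · exact absurd (rev_eq_self_of_val hN ha).symm hr

/-- The eigenvalues of the partial sums of the quadratic form on Fock space, up to an affine
normalization. -/
def formWeight (N a : ℕ) (i : Fin n → Fin 2) : ℂ :=
  q ^ (2 * (2 * a - N)) * signWeight q (min a (N - a)) i ^ 2

theorem formWeight_castLE (h2 : 2 * n ≤ N) (k : Fin n) (i : Fin n → Fin 2) :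
    formWeight q N k i = signWeight q k i ^ 2 := by
  have hk := k.2
  unfold formWeight
  -- Truncated subtraction is intended: the power of `q` in `formWeight` is trivial on the first
  -- half of the indices and starts to grow only past the middle.
  rw [show 2 * (k : ℕ) - N = 0 by omega, show min (k : ℕ) (N - k) = k by omega]
  simp

theorem formWeight_castLE_succ (h2 : 2 * n ≤ N) (k : Fin n) (i : Fin n → Fin 2) :
    formWeight q N (k + 1) i = (q ^ 4) ^ (i k : ℕ) * signWeight q k i ^ 2 := by
  have hk := k.2
  unfold formWeight
  rw [show 2 * ((k : ℕ) + 1) - N = 0 by omega, show min ((k : ℕ) + 1) (N - (k + 1)) = k + 1 by omega,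
    signWeight_succ, mul_pow, ← pow_mul, mul_comm _ 2,
    pow_mul (-q ^ 2)]
  ring

theorem formWeight_rev (h2 : 2 * n ≤ N) (k : Fin n) (i : Fin n → Fin 2) :
    formWeight q N ((Fin.castLE (by omega) k : Fin N).rev : ℕ) i
      = (q ^ (N - 2 * k - 2)) ^ 2 * ((q ^ 4) ^ (i k : ℕ) * signWeight q k i ^ 2) := by
  have hk := k.2
  unfold formWeight
  rw [Fin.val_rev, Fin.val_castLE, show 2 * (N - (k + 1)) - N = N - 2 * (k : ℕ) - 2 by omega,
    show min (N - ((k : ℕ) + 1)) (N - (N - (k + 1))) = k + 1 by omega,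
    signWeight_succ, mul_pow, ← pow_mul, ← pow_mul, mul_comm _ 2, mul_comm _ 2, pow_mul (-q ^ 2)]
  ring

theorem formWeight_rev_succ (h2 : 2 * n ≤ N) (k : Fin n) (i : Fin n → Fin 2) :
    formWeight q N (((Fin.castLE (by omega) k : Fin N).rev : ℕ) + 1) i
      = (q ^ (N - 2 * k - 2)) ^ 2 * (q ^ 4 * signWeight q k i ^ 2) := by
  have hk := k.2
  unfold formWeight
  rw [Fin.val_rev, Fin.val_castLE,
    show 2 * (N - (k + 1) + 1) - N = (N - 2 * (k : ℕ) - 2) + 2 by omega,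
    show min (N - ((k : ℕ) + 1) + 1) (N - (N - (k + 1) + 1)) = k by omega]
  ring

theorem formWeight_middle (hN : N = 2 * n + 1) (i : Fin n → Fin 2) :
    formWeight q N n i = signWeight q n i ^ 2 := by
  unfold formWeight
  rw [show 2 * n - N = 0 by omega, show min n (N - n) = n by omega]
  simp

theorem formWeight_middle_succ (hN : N = 2 * n + 1) (i : Fin n → Fin 2) :
    formWeight q N (n + 1) i = q ^ 2 * signWeight q n i ^ 2 := by
  unfold formWeight
  rw [show 2 * (n + 1) - N = 1 by omega, show min (n + 1) (N - (n + 1)) = n by omega]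

theorem formWeight_zero (i : Fin n → Fin 2) : formWeight q N 0 i = 1 := by
  simp [formWeight, signWeight_zero]

theorem formWeight_total (i : Fin n → Fin 2) : formWeight q N N i = q ^ (2 * N) := by
  simp [formWeight, signWeight_zero, show 2 * N - N = N by omega]

variable {q c ν} (hq0 : q ≠ 0) (hq : ∀ m : ℕ, 0 < m → q ^ m ≠ 1) (hν : ν = 1 ∨ ν = -1)
  (h2 : 2 * n ≤ N) (h3 : N ≤ 2 * n + 1)
include hq0 hq hν h2 h3

/-- Each term of the quadratic form is diagonal and is an increment of `formWeight`, so the partial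
sums telescope. -/
theorem fockGen_mul_rev_apply (a : Fin N) (f : (Fin n → Fin 2) → ℂ) (i : Fin n → Fin 2) :
    (fockGen q c ν n a * fockGen q c ν n a.rev) f i
      = q ^ twoRho a * (c ^ 2 / (q ^ 2 - 1) *
          (formWeight q N (a + 1) i - formWeight q N a i)) * f i := by
  have h1 : q ^ 2 - 1 ≠ 0 := sub_ne_zero.2 (hq _ (by omega))
  rcases index_cases h2 h3 a with ⟨k, rfl⟩ | ⟨k, rfl⟩ | ⟨hN, ha⟩
  · rw [fockGen_castLE, fockGen_rev_castLE q c ν h2, mul_smul_comm, twoRho_castLE h2, zpow_natCast,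
      LinearMap.smul_apply, Pi.smul_apply, Fin.val_castLE, formWeight_castLE q h2,
      formWeight_castLE_succ q h2]
    have := ladder_mul_ladder_apply q k 1 f i
    rw [show (1 + 1 : Fin 2) = 0 from rfl] at this
    rw [this, smul_eq_mul]
    generalize i k = b
    fin_cases b
    · simp
    · simp
      field_simp
      ring
  · rw [Fin.rev_rev, fockGen_castLE, fockGen_rev_castLE q c ν h2, smul_mul_assoc, twoRho_rev,
      twoRho_castLE h2, zpow_neg, zpow_natCast, LinearMap.smul_apply, Pi.smul_apply,
      formWeight_rev q h2, formWeight_rev_succ q h2]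
    have := ladder_mul_ladder_apply q k 0 f i
    rw [show (0 + 1 : Fin 2) = 1 from rfl] at this
    rw [this, smul_eq_mul]
    have hr : q ^ (N - 2 * (k : ℕ) - 2) ≠ 0 := pow_ne_zero _ hq0
    generalize q ^ (N - 2 * (k : ℕ) - 2) = r at hr ⊢
    generalize i k = b
    fin_cases b
    · simp
      field_simp
      ring
    · simp
  · have hr := rev_eq_self_of_val hN ha
    rw [hr, twoRho_of_rev_eq hr, fockGen_middle q c ν hN ha, Module.End.mul_apply, diagOp_apply,
      diagOp_apply, ha, formWeight_middle q hN, formWeight_middle_succ q hN, zpow_zero]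
    -- The middle operator enters through its square, so both signs satisfy the same relations.
    have : ν ^ 2 = 1 := by rcases hν with rfl | rfl <;> norm_num
    field_simp
    linear_combination c ^ 2 * f i * signWeight q n i ^ 2 * this

theorem partialForm_fockGen_apply {a : ℕ} (ha : a ≤ N) (f : (Fin n → Fin 2) → ℂ)
    (i : Fin n → Fin 2) :
    partialForm q (fockGen q c ν n : Fin N → _) a f i
      = c ^ 2 / (q ^ 2 - 1) * (formWeight q N a i - 1) * f i := by
  unfold partialForm
  rw [LinearMap.sum_apply, Finset.sum_apply]
  have h : ∀ k : Fin N, (if (k : ℕ) < a then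
        q ^ (-twoRho k) • (fockGen q c ν n k * fockGen q c ν n k.rev) else 0) f i
      = (fun k : ℕ => if k < a then c ^ 2 / (q ^ 2 - 1) *
          (formWeight q N (k + 1) i - formWeight q N k i) * f i else 0) k := by
    intro k
    dsimp only
    split_ifs
    · rw [LinearMap.smul_apply, Pi.smul_apply, fockGen_mul_rev_apply hq0 hq hν h2 h3, smul_eq_mul,
        zpow_neg]
      have := zpow_ne_zero (twoRho k) hq0
      field_simp
    · rfl
  rw [Finset.sum_congr rfl fun k _ => h k, Fin.sum_univ_eq_sum_range (fun k : ℕ => if k < a then c ^ 2 / (q ^ 2 - 1) *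
          (formWeight q N (k + 1) i - formWeight q N k i) * f i else 0), ← Finset.sum_filter,
    show (Finset.range N).filter (· < a) = Finset.range a by
      ext k
      simp only [Finset.mem_filter, Finset.mem_range]
      omega,
    ← Finset.sum_mul, ← Finset.mul_sum, Finset.sum_range_sub (fun k => formWeight q N k i),
    formWeight_zero]

theorem cliffordRel_fockGen : CliffordRel q c (fockGen q c ν n : Fin N → _) := by
  have h1 : q ^ 2 - 1 ≠ 0 := sub_ne_zero.2 (hq _ (by omega))
  constructor
  · refine LinearMap.ext fun f => funext fun i => ?_
    -- At `a = N` the eigenvalue no longer depends on the occupation, so the full form is a scalar.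
    rw [partialForm_fockGen_apply hq0 hq hν h2 h3 le_rfl, formWeight_total, LinearMap.smul_apply,
      Pi.smul_apply, Module.End.one_apply, smul_eq_mul]
    ring
  · intro a b
    by_cases hab : a = b.rev
    · obtain rfl : b = a.rev := by rw [hab, Fin.rev_rev]
      refine LinearMap.ext fun f => funext fun i => ?_
      have hm := fockGen_mul_rev_apply (c := c) hq0 hq hν h2 h3 a f i
      have hm' := fockGen_mul_rev_apply (c := c) hq0 hq hν h2 h3 a.rev f i
      have hs := partialForm_fockGen_apply (c := c) hq0 hq hν h2 h3 a.rev.2.le f i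
      rw [Fin.rev_rev] at hm'
      have hmet : metric q a a.rev = q ^ (-twoRho a) := by simp [metric, delta]
      rw [hmet]
      simp only [LinearMap.add_apply, LinearMap.smul_apply, Pi.add_apply, Pi.smul_apply,
        smul_eq_mul, Module.End.one_apply, hm, hm', hs, Fin.rev_rev, if_true]
      rcases index_cases h2 h3 a with ⟨k, rfl⟩ | ⟨k, rfl⟩ | ⟨hN, ha⟩
      · have hk := k.2
        have hlt : (Fin.castLE (by omega) k : Fin N) < (Fin.castLE (by omega) k : Fin N).rev := by
          rw [Fin.lt_def, Fin.val_rev, Fin.val_castLE]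
          omega
        rw [if_pos hlt, if_neg hlt.ne, formWeight_rev q h2, formWeight_rev_succ q h2,
          Fin.val_castLE, formWeight_castLE q h2, formWeight_castLE_succ q h2, twoRho_rev,
          twoRho_castLE h2, zpow_neg, zpow_natCast, LinearMap.smul_apply, Pi.smul_apply, hm,
          Fin.val_castLE, formWeight_castLE q h2, formWeight_castLE_succ q h2, twoRho_castLE h2,
          zpow_natCast, smul_eq_mul, show (0 - 2 : ℤ) = -(2 : ℕ) from rfl, zpow_neg, zpow_natCast]
        have hr : q ^ (N - 2 * (k : ℕ) - 2) ≠ 0 := pow_ne_zero _ hq0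
        field_simp
        ring
      · have hk := k.2
        have hlt : (Fin.castLE (by omega) k : Fin N) < (Fin.castLE (by omega) k : Fin N).rev := by
          rw [Fin.lt_def, Fin.val_rev, Fin.val_castLE]
          omega
        simp only [Fin.rev_rev]
        rw [if_neg hlt.not_gt, if_neg hlt.ne', formWeight_rev q h2, formWeight_rev_succ q h2,
          Fin.val_castLE, formWeight_castLE q h2, formWeight_castLE_succ q h2, twoRho_rev,
          twoRho_castLE h2, neg_neg, zpow_neg, zpow_natCast, LinearMap.zero_apply, Pi.zero_apply,
          show (0 - 2 : ℤ) = -(2 : ℕ) from rfl, zpow_neg, zpow_natCast]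
        have hr : q ^ (N - 2 * (k : ℕ) - 2) ≠ 0 := pow_ne_zero _ hq0
        field_simp
        ring
      · have hr := rev_eq_self_of_val hN ha
        simp only [hr, twoRho_of_rev_eq hr, ha, formWeight_middle q hN,
          formWeight_middle_succ q hN, lt_irrefl, if_false, if_true, LinearMap.zero_apply,
          Pi.zero_apply, sub_self, neg_zero, zpow_zero]
        field_simp
        ring
    · have hmet : metric q a b = 0 := by simp [metric, delta, hab]
      rw [hmet, zero_smul, if_neg hab]
      rcases lt_trichotomy a b with h | rfl | h
      · have hba : b ≠ a.rev := fun h' => hab (by rw [h', Fin.rev_rev])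
        rw [if_neg h.ne, if_pos h, fockGen_exchange q c ν h2 h3 h hba, sub_self, zpow_zero,
          one_smul, ← add_smul, ← add_smul]
        convert zero_smul ℂ _
        ring
      · rw [fockGen_mul_self q c ν h2 h3 hab]
        simp
      · rw [if_neg h.ne', if_neg h.not_gt, fockGen_exchange q c ν h2 h3 h hab, sub_self, zpow_zero,
          one_smul, smul_smul, add_zero, mul_neg, inv_mul_cancel₀ (pow_ne_zero 2 hq0), neg_one_smul,
          neg_add_cancel]

end Fock

/-! ### Consequences of the relations in an arbitrary algebra -/

section Relations

set_option linter.unusedSectionVars false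

variable {A : Type*} [Ring A] [Algebra ℂ A] {n N : ℕ} {q c ν : ℂ} {X : Fin N → A}

theorem mul_list_prod {ι : Type*} {x : A} {g : ι → A} {t : ι → ℂ} (L : List ι)
    (h : ∀ k ∈ L, x * g k = t k • (g k * x)) :
    x * (L.map g).prod = (L.map t).prod • ((L.map g).prod * x) := by
  induction L with
  | nil => simp
  | cons k L ih =>
    have ih := ih fun l hl => h l (List.mem_cons_of_mem _ hl)
    simp only [List.map_cons, List.prod_cons]
    rw [← mul_assoc, h k List.mem_cons_self, smul_mul_assoc, mul_assoc, ih, mul_smul_comm, smul_smul,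
      mul_assoc]

theorem mul_pow_of_exchange {x y : A} {t : ℂ} (h : x * y = t • (y * x)) (m : ℕ) :
    x * y ^ m = t ^ m • (y ^ m * x) := by
  have := mul_list_prod (x := x) (g := fun _ : ℕ => y) (t := fun _ => t) (List.range m)
    fun _ _ => h
  simpa using this

namespace CliffordRel

variable (hX : CliffordRel q c X)
include hX

theorem mul_of_lt {a b : Fin N} (h : a < b) (hr : b ≠ a.rev) :
    X b * X a = (-q ^ 2) • (X a * X b) := by
  have hab : a ≠ b.rev := fun h' => hr (by rw [h', Fin.rev_rev])
  have hmet : metric q a b = 0 := by simp [metric, delta, hab]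
  have := hX.exchange a b
  rw [hmet, zero_smul, if_pos h, if_neg h.ne, if_neg hab, sub_self, zpow_zero, one_smul] at this
  rw [← sub_eq_zero, ← this]
  module

theorem mul_self_eq_zero (hq0 : q ≠ 0) (hq : ∀ m : ℕ, 0 < m → q ^ m ≠ 1) {a : Fin N}
    (hr : a ≠ a.rev) : X a * X a = 0 := by
  have hmet : metric q a a = 0 := by simp [metric, delta, hr]
  have := hX.exchange a a
  rw [hmet, zero_smul, if_neg (lt_irrefl a), if_pos rfl, if_neg hr, sub_zero, add_zero,
    ← add_smul, add_comm] at this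
  exact (smul_eq_zero_iff_right (sq_add_inv_ne_zero hq0 hq)).1 this

/-- The q-analogue of the canonical anticommutation relation, read from `exchange` times `q²`. Its
scalar term is the normalization of the annihilators in `fockGen`; the partial form involves only
modes before `k`. -/
theorem rev_mul (hq0 : q ≠ 0) (h2 : 2 * n ≤ N) (k : Fin n) :
    X (Fin.castLE (by omega) k).rev * X (Fin.castLE (by omega) k)
      = -(X (Fin.castLE (by omega) k) * X (Fin.castLE (by omega) k).rev)
        + q ^ (N - 2 * k - 2) • ((q ^ 4 - 1) • partialForm q X k
          + (c ^ 2 * (1 + q ^ 2)) • (1 : A)) := by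
  have hk := k.2
  have hlt : (Fin.castLE (by omega) k : Fin N) < (Fin.castLE (by omega) k : Fin N).rev := by
    rw [Fin.lt_def, Fin.val_rev, Fin.val_castLE]
    omega
  have hmet : metric q (Fin.castLE (by omega) k : Fin N).rev (Fin.castLE (by omega) k)
      = q ^ (N - 2 * (k : ℕ) - 2) := by
    simp [metric, delta, twoRho_rev, twoRho_castLE h2]
  have := hX.exchange (Fin.castLE (by omega) k : Fin N).rev (Fin.castLE (by omega) k)
  rw [hmet, if_neg hlt.not_gt, if_neg hlt.ne', if_pos rfl, show (0 - 2 : ℤ) = -(2 : ℕ) from rfl,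
    zpow_neg, zpow_natCast, add_zero, Fin.val_castLE] at this
  have h := congrArg (fun y => q ^ 2 • y) this
  simp only [smul_add, smul_smul] at h ⊢
  rw [mul_inv_cancel₀ (pow_ne_zero 2 hq0), one_smul, one_smul] at h
  rw [eq_sub_of_add_eq h, neg_add_eq_sub]
  congr 1
  congr 1
  · congr 1
    field_simp
  · congr 1
    field_simp
    ring

theorem middle_mul_self (hq0 : q ≠ 0) (hq : ∀ m : ℕ, 0 < m → q ^ m ≠ 1) {a : Fin N}
    (hr : a.rev = a) :
    X a * X a = c ^ 2 • (1 : A) + (q ^ 2 - 1) • partialForm q X a := by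
  have hmet : metric q a a = 1 := by simp [metric, delta, hr, twoRho_of_rev_eq hr]
  have := hX.exchange a a
  rw [hmet, hr, if_neg (lt_irrefl a), if_pos rfl, sub_self, zpow_zero, add_zero,
    ← add_smul, one_smul] at this
  have h1 : q ^ 2 + 1 ≠ 0 := by
    intro h
    apply hq 4 (by norm_num)
    linear_combination (q ^ 2 - 1) * h
  have h := congrArg (fun y => (q ^ 2 / (q ^ 2 + 1)) • y) this
  simp only [smul_add, smul_smul] at h
  rw [show q ^ 2 / (q ^ 2 + 1) * ((q ^ 2)⁻¹ + 1) = 1 by field_simp; ring, one_smul] at h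
  rw [h, add_comm]
  congr 2
  · field_simp
  · field_simp
    ring

end CliffordRel

/-- For `a ≤ n` the partial form is normally ordered, with annihilators on the right. -/
theorem partialForm_mul_eq_zero (h2 : 2 * n ≤ N) {a : ℕ} (ha : a ≤ n) {w : A}
    (hw : ∀ k : Fin n, (k : ℕ) < a → X (Fin.castLE (by omega) k).rev * w = 0) :
    partialForm q X a * w = 0 := by
  unfold partialForm
  rw [Finset.sum_mul]
  refine Finset.sum_eq_zero fun k _ => ?_
  split_ifs with hk
  · rw [smul_mul_assoc, mul_assoc]
    have := hw ⟨k, by omega⟩ hk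
    rw [show (Fin.castLE (by omega) (⟨k, by omega⟩ : Fin n) : Fin N) = k from rfl] at this
    rw [this, mul_zero, smul_zero]
  · rw [zero_mul]

theorem finRange_split (j : Fin n) : ∃ L₁ L₂, List.finRange n = L₁ ++ j :: L₂ ∧
    (∀ k ∈ L₁, k < j) ∧ ∀ k ∈ L₂, j < k := by
  obtain ⟨L₁, L₂, h⟩ := List.append_of_mem (List.mem_finRange j)
  have hs : (L₁ ++ j :: L₂).Pairwise (· < ·) := h ▸ List.pairwise_lt_finRange n
  rw [List.pairwise_append, List.pairwise_cons] at hs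
  exact ⟨L₁, L₂, h, fun k hk => hs.2.2 k hk j List.mem_cons_self, fun k hk => hs.2.1.1 k hk⟩

/-- Identifies the Fock weight with the factor collected when a generator of mode `j` moves past all
earlier modes of an ordered monomial. -/
theorem signWeight_eq_list_prod (q : ℂ) {j : Fin n} {L₁ L₂ : List (Fin n)}
    (h : List.finRange n = L₁ ++ j :: L₂) (h₁ : ∀ k ∈ L₁, k < j) (h₂ : ∀ k ∈ L₂, j < k)
    (i : Fin n → Fin 2) :
    signWeight q j i = (L₁.map fun k => (-q ^ 2) ^ (i k : ℕ)).prod := by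
  unfold signWeight
  rw [← List.prod_ofFn, List.ofFn_eq_map, h, List.map_append, List.prod_append, List.map_cons,
    List.prod_cons, if_neg (lt_irrefl _), one_mul, List.prod_eq_one (l := L₂.map _), mul_one]
  · congr 1
    refine List.map_congr_left fun k hk => if_pos (h₁ k hk)
  · intro x hx
    obtain ⟨k, hk, rfl⟩ := List.mem_map.1 hx
    exact if_neg (h₂ k hk).not_gt

theorem signWeight_eq_finRange_prod (q : ℂ) (i : Fin n → Fin 2) :
    signWeight q n i = ((List.finRange n).map fun k => (-q ^ 2) ^ (i k : ℕ)).prod := by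
  unfold signWeight
  rw [← List.prod_ofFn, List.ofFn_eq_map]
  congr 1
  exact List.map_congr_left fun k _ => if_pos k.2

/-- The ordered product of the `X_k^{i_k}` over the modes `k` in the list `L`. -/
def listMonomial (h : n ≤ N) (X : Fin N → A) (L : List (Fin n)) (i : Fin n → Fin 2) : A :=
  (L.map fun k => X (Fin.castLE h k) ^ (i k : ℕ)).prod

theorem listMonomial_append_cons (h : n ≤ N) (L₁ L₂ : List (Fin n)) (j : Fin n)
    (i : Fin n → Fin 2) : listMonomial h X (L₁ ++ j :: L₂) i
      = listMonomial h X L₁ i * (X (Fin.castLE h j) ^ (i j : ℕ) * listMonomial h X L₂ i) := by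
  simp [listMonomial]

theorem listMonomial_update (h : n ≤ N) {L : List (Fin n)} {j : Fin n} (hj : j ∉ L)
    (i : Fin n → Fin 2) (b : Fin 2) :
    listMonomial h X L (Function.update i j b) = listMonomial h X L i := by
  unfold listMonomial
  congr 1
  refine List.map_congr_left fun k hk => ?_
  rw [Function.update_of_ne]
  rintro rfl
  exact hj hk

theorem listMonomial_finRange_zero (h : n ≤ N) : listMonomial h X (List.finRange n) 0 = 1 := by
  simp [listMonomial]

theorem mul_listMonomial (h : n ≤ N) {L : List (Fin n)} {x : A}
    (hx : ∀ k ∈ L, x * X (Fin.castLE h k) = (-q ^ 2) • (X (Fin.castLE h k) * x))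
    (i : Fin n → Fin 2) :
    x * listMonomial h X L i
      = (L.map fun k => (-q ^ 2) ^ (i k : ℕ)).prod • (listMonomial h X L i * x) :=
  mul_list_prod L fun k hk => mul_pow_of_exchange (hx k hk) _

namespace CliffordRel

variable (hX : CliffordRel q c X)
include hX

theorem castLE_mul_listMonomial (hq0 : q ≠ 0) (hq : ∀ m : ℕ, 0 < m → q ^ m ≠ 1)
    (h2 : 2 * n ≤ N) (j : Fin n) (i : Fin n → Fin 2) :
    X (Fin.castLE (by omega) j) * listMonomial (by omega) X (List.finRange n) i
      = if i j = 0 then signWeight q j i •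
          listMonomial (by omega) X (List.finRange n) (Function.update i j 1) else 0 := by
  have hj := j.2
  obtain ⟨L₁, L₂, h, h₁, h₂⟩ := finRange_split j
  have hj₁ : j ∉ L₁ := fun hj => lt_irrefl _ (h₁ _ hj)
  have hj₂ : j ∉ L₂ := fun hj => lt_irrefl _ (h₂ _ hj)
  have hne : (Fin.castLE (by omega) j : Fin N) ≠ (Fin.castLE (by omega) j : Fin N).rev := by
    rw [Ne, Fin.ext_iff, Fin.val_rev, Fin.val_castLE]
    omega
  rw [h, listMonomial_append_cons, listMonomial_append_cons, listMonomial_update _ hj₁,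
    listMonomial_update _ hj₂, ← mul_assoc, mul_listMonomial (q := q), smul_mul_assoc,
    ← signWeight_eq_list_prod q h h₁ h₂, Function.update_self, mul_assoc,
    ← mul_assoc (X _) (X _ ^ _) _]
  · rcases Fin.exists_fin_two.1 ⟨i j, rfl⟩ with hij | hij
    · simp [hij]
    · simp [hij, hX.mul_self_eq_zero hq0 hq hne]
  · intro k hk
    have hkj : k < j := h₁ k hk
    refine hX.mul_of_lt hkj ?_
    rw [Ne, Fin.ext_iff, Fin.val_rev, Fin.val_castLE, Fin.val_castLE]
    omega

theorem rev_mul_castLE (h2 : 2 * n ≤ N) {j k : Fin n} (hjk : j ≠ k) :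
    X (Fin.castLE (by omega) j).rev * X (Fin.castLE (by omega) k)
      = (-q ^ 2) • (X (Fin.castLE (by omega) k) * X (Fin.castLE (by omega) j).rev) := by
  have hj := j.2
  have hk := k.2
  have hjk' : (j : ℕ) ≠ k := fun h => hjk (Fin.ext h)
  refine hX.mul_of_lt ?_ ?_
  · rw [Fin.lt_def, Fin.val_rev, Fin.val_castLE, Fin.val_castLE]
    omega
  · rw [Ne, Fin.rev_inj, Fin.ext_iff, Fin.val_castLE, Fin.val_castLE]
    exact hjk'

theorem rev_mul_listMonomial_mul (h2 : 2 * n ≤ N) {φ : A}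
    (hφ : ∀ k : Fin n, X (Fin.castLE (by omega) k).rev * φ = 0) {L : List (Fin n)} {j : Fin n}
    (hj : j ∉ L) (i : Fin n → Fin 2) :
    X (Fin.castLE (by omega) j).rev * (listMonomial (by omega) X L i * φ) = 0 := by
  rw [← mul_assoc, mul_listMonomial (q := q), smul_mul_assoc, mul_assoc, hφ, mul_zero, smul_zero]
  intro k hk
  refine hX.rev_mul_castLE h2 ?_
  rintro rfl
  exact hj hk

theorem rev_mul_listMonomial (hq0 : q ≠ 0) (h2 : 2 * n ≤ N) {φ : A}
    (hφ : ∀ k : Fin n, X (Fin.castLE (by omega) k).rev * φ = 0) (j : Fin n) (i : Fin n → Fin 2) :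
    X (Fin.castLE (by omega) j).rev * (listMonomial (by omega) X (List.finRange n) i * φ)
      = if i j = 1 then (c ^ 2 * (1 + q ^ 2) * q ^ (N - 2 * j - 2) * signWeight q j i) •
          (listMonomial (by omega) X (List.finRange n) (Function.update i j 0) * φ) else 0 := by
  obtain ⟨L₁, L₂, h, h₁, h₂⟩ := finRange_split j
  have hj₁ : j ∉ L₁ := fun hj => lt_irrefl _ (h₁ _ hj)
  have hj₂ : j ∉ L₂ := fun hj => lt_irrefl _ (h₂ _ hj)
  have hw : X (Fin.castLE (by omega) j).rev * (listMonomial (by omega) X L₂ i * φ) = 0 :=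
    hX.rev_mul_listMonomial_mul h2 hφ hj₂ i
  -- The correction in `rev_mul` involves annihilators of modes before `j`. They q-commute with the
  -- later modes in `L₂` and reach `φ`, so only the scalar term survives.
  have hf : partialForm q X j * (listMonomial (by omega) X L₂ i * φ) = 0 := by
    refine partialForm_mul_eq_zero h2 j.2.le fun k hk => ?_
    exact hX.rev_mul_listMonomial_mul h2 hφ (fun hk' => absurd (h₂ k hk') (not_lt.2 hk.le)) i
  rw [h, listMonomial_append_cons, listMonomial_append_cons, listMonomial_update _ hj₁,
    listMonomial_update _ hj₂, mul_assoc, ← mul_assoc (X _), mul_listMonomial (q := q),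
    smul_mul_assoc, ← signWeight_eq_list_prod q h h₁ h₂, Function.update_self]
  · simp only [mul_assoc]
    rcases Fin.exists_fin_two.1 ⟨i j, rfl⟩ with hij | hij
    · simp [hij, hw]
    · rw [if_pos hij, hij]
      simp only [Fin.val_one, Fin.val_zero, pow_one, pow_zero, one_mul]
      rw [← mul_assoc (X _) (X _) _, hX.rev_mul hq0 h2, add_mul, neg_mul, mul_assoc, hw,
        smul_mul_assoc, add_mul, smul_mul_assoc, hf]
      simp only [mul_zero, neg_zero, smul_zero, zero_add, smul_mul_assoc, one_mul, mul_smul_comm,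
        smul_smul]
      congr 1
      ring
  · intro k hk
    refine hX.rev_mul_castLE h2 ?_
    rintro rfl
    exact hj₁ hk

theorem middle_mul_listMonomial (hN : N = 2 * n + 1) {a : Fin N} (ha : (a : ℕ) = n)
    {φ : A} {r : ℂ} (hφ : X a * φ = r • φ) (i : Fin n → Fin 2) :
    X a * (listMonomial (by omega) X (List.finRange n) i * φ)
      = (r * signWeight q n i) • (listMonomial (by omega) X (List.finRange n) i * φ) := by
  rw [← mul_assoc, mul_listMonomial (q := q), smul_mul_assoc, mul_assoc, hφ, mul_smul_comm,
    smul_smul, ← signWeight_eq_finRange_prod, mul_comm]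
  intro k _
  have hk := k.2
  refine hX.mul_of_lt ?_ ?_
  · rw [Fin.lt_def, Fin.val_castLE]
    omega
  · rw [Ne, Fin.ext_iff, Fin.val_rev, Fin.val_castLE]
    omega

end CliffordRel

/-! ### The intertwiner from Fock space -/

theorem ladder_single (q : ℂ) (j : Fin n) (b : Fin 2) (i : Fin n → Fin 2) :
    ladder q j b (Pi.single i 1)
      = if i j = b + 1 then signWeight q j i • Pi.single (Function.update i j b) 1 else 0 := by
  funext l
  rw [ladder_apply]
  by_cases hl : l j = b
  · rw [if_pos hl]
    by_cases hi : i j = b + 1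
    · rw [if_pos hi, Pi.smul_apply, smul_eq_mul]
      by_cases h : l = Function.update i j b
      · subst h
        simp [signWeight_update_of_le, ← hi]
      · rw [Pi.single_eq_of_ne h, Pi.single_eq_of_ne, mul_zero, mul_zero]
        intro h'
        apply h
        rw [← h', Function.update_idem, ← hl, Function.update_eq_self]
    · rw [if_neg hi, Pi.single_eq_of_ne, mul_zero, Pi.zero_apply]
      intro h'
      apply hi
      rw [← h', Function.update_self]
  · rw [if_neg hl]
    split_ifs
    · rw [Pi.smul_apply, Pi.single_eq_of_ne, smul_zero]
      rintro rfl
      exact hl (Function.update_self ..)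
    · rfl

theorem diagOp_single (w : (Fin n → Fin 2) → ℂ) (i : Fin n → Fin 2) :
    diagOp w (Pi.single i 1) = w i • Pi.single i 1 := by
  funext l
  rw [diagOp_apply, Pi.smul_apply, smul_eq_mul]
  by_cases h : l = i
  · rw [h]
  · rw [Pi.single_eq_of_ne h, mul_zero, mul_zero]

/-- The linear map from Fock space that sends the basis vector of occupation `i` to the ordered
monomial with exponents `i` applied to the vacuum `φ`. -/
def fromFock (h : n ≤ N) (X : Fin N → A) (φ : A) : ((Fin n → Fin 2) → ℂ) →ₗ[ℂ] A :=
  Fintype.linearCombination ℂ fun i => listMonomial h X (List.finRange n) i * φ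

theorem fromFock_single (h : n ≤ N) (φ : A) (i : Fin n → Fin 2) :
    fromFock h X φ (Pi.single i 1) = listMonomial h X (List.finRange n) i * φ := by
  rw [fromFock, Fintype.linearCombination_apply_single, one_smul]

theorem fromFock_fockGen (hX : CliffordRel q c X) (hq0 : q ≠ 0)
    (hq : ∀ m : ℕ, 0 < m → q ^ m ≠ 1) (h2 : 2 * n ≤ N) (h3 : N ≤ 2 * n + 1) {φ : A}
    (hφ : ∀ k : Fin n, X (Fin.castLE (by omega) k).rev * φ = 0)
    (hφm : N = 2 * n + 1 → ∀ a : Fin N, (a : ℕ) = n → X a * φ = (ν * c) • φ) (a : Fin N)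
    (f : (Fin n → Fin 2) → ℂ) :
    fromFock (by omega) X φ (fockGen q c ν n a f) = X a * fromFock (by omega) X φ f := by
  have key : fromFock (by omega) X φ ∘ₗ fockGen q c ν n a
      = LinearMap.mulLeft ℂ (X a) ∘ₗ fromFock (by omega) X φ := by
    refine LinearMap.pi_ext' fun i => LinearMap.ext_ring ?_
    simp only [LinearMap.comp_apply, LinearMap.single_apply, LinearMap.mulLeft_apply,
      fromFock_single]
    rcases index_cases h2 h3 a with ⟨k, rfl⟩ | ⟨k, rfl⟩ | ⟨hN, ha⟩
    · rw [fockGen_castLE, ladder_single, ← mul_assoc, hX.castLE_mul_listMonomial hq0 hq h2,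
        show (1 + 1 : Fin 2) = 0 from rfl]
      split_ifs
      · rw [map_smul, fromFock_single, smul_mul_assoc]
      · rw [map_zero, zero_mul]
    · rw [fockGen_rev_castLE q c ν h2, LinearMap.smul_apply, ladder_single,
        hX.rev_mul_listMonomial hq0 h2 hφ, zero_add]
      split_ifs
      · rw [map_smul, map_smul, fromFock_single, smul_smul]
      · rw [smul_zero, map_zero]
    · rw [fockGen_middle q c ν hN ha, diagOp_single, map_smul, fromFock_single,
        hX.middle_mul_listMonomial hN ha (hφm hN a ha)]
  exact LinearMap.congr_fun key f

/-- Irreducibility of Fock space, by induction on the number of annihilators that do not kill `f`.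
Applying one of them lowers this number: it squares to zero, and by q-commutation it revives no
other. -/
theorem single_zero_mem {W : Submodule ℂ ((Fin n → Fin 2) → ℂ)} (hq0 : q ≠ 0)
    (hW : ∀ j, ∀ f ∈ W, ladder q j 0 f ∈ W) {f : (Fin n → Fin 2) → ℂ} (hf : f ∈ W)
    (hf0 : f ≠ 0) : Pi.single 0 1 ∈ W := by
  classical
  induction hm : (Finset.univ.filter fun j => ladder q j 0 f ≠ 0).card using
    Nat.strong_induction_on generalizing f with
  | _ m ih =>
    by_cases h : ∃ j, ladder q j 0 f ≠ 0
    · obtain ⟨j, hj⟩ := h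
      refine ih _ ?_ (hW j f hf) hj rfl
      rw [← hm]
      refine Finset.card_lt_card ((Finset.ssubset_iff_of_subset ?_).2 ⟨j, ?_, ?_⟩)
      · intro k hk
        rw [Finset.mem_filter] at hk ⊢
        refine ⟨Finset.mem_univ k, fun hk0 => hk.2 ?_⟩
        rcases lt_trichotomy k j with hkj | rfl | hkj
        · have := LinearMap.congr_fun (ladder_zero_mul_ladder q hkj 0) f
          rw [Module.End.mul_apply, LinearMap.smul_apply, Module.End.mul_apply, hk0, map_zero,
            smul_zero] at this
          exact this
        · rw [hk0, map_zero]
        · have := LinearMap.congr_fun (ladder_zero_mul_ladder q hkj 0) f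
          rw [Module.End.mul_apply, LinearMap.smul_apply, Module.End.mul_apply, hk0, map_zero] at this
          exact (smul_eq_zero_iff_right (neg_ne_zero.2 (pow_ne_zero 2 hq0))).1 this.symm
      · simpa using hj
      · rw [Finset.mem_filter, not_and, not_not]
        intro _
        exact LinearMap.congr_fun (ladder_mul_self q j 0) f
    · push Not at h
      have hfi : ∀ i, i ≠ 0 → f i = 0 := by
        intro i hi
        obtain ⟨j, hj⟩ := Function.ne_iff.1 hi
        have hj1 : i j = 1 := Fin.eq_one_of_ne_zero _ hj
        -- Evaluating the annihilated vector with mode `j` emptied recovers `f i` up to a nonzero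
        -- weight.
        have := congrFun (h j) (Function.update i j 0)
        rw [ladder_apply, Function.update_self, if_pos rfl, Function.update_idem, zero_add, ← hj1,
          Function.update_eq_self, Pi.zero_apply] at this
        exact (mul_eq_zero.1 this).resolve_left (signWeight_ne_zero hq0 _ _)
      have hfs : f = f 0 • Pi.single 0 1 := by
        funext i
        by_cases hi : i = 0
        · rw [hi]
          simp
        · rw [hfi i hi, Pi.smul_apply, Pi.single_eq_of_ne hi, smul_zero]
      have h0 : f 0 ≠ 0 := by
        intro h0
        rw [h0, zero_smul] at hfs
        exact hf0 hfs
      rw [hfs] at hf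
      exact (W.smul_mem_iff h0).1 hf

/-! ### The vacuum -/

/-- The product of the annihilators `X_{k'}` over the modes `k` in the list `L`. -/
def annihilatorProd (h : n ≤ N) (X : Fin N → A) (L : List (Fin n)) : A :=
  (L.map fun k => X (Fin.castLE h k).rev).prod

theorem CliffordRel.rev_mul_annihilatorProd (hX : CliffordRel q c X) (hq0 : q ≠ 0)
    (hq : ∀ m : ℕ, 0 < m → q ^ m ≠ 1) (h2 : 2 * n ≤ N) {L : List (Fin n)} {j : Fin n}
    (hj : j ∈ L) :
    X (Fin.castLE (by omega) j).rev * annihilatorProd (by omega) X L = 0 := by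
  have hex : ∀ k : Fin n, k ≠ j → ∃ t : ℂ,
      X (Fin.castLE (by omega) j).rev * X (Fin.castLE (by omega) k).rev
        = t • (X (Fin.castLE (by omega) k).rev * X (Fin.castLE (by omega) j).rev) := by
    intro k hkj
    have hj := j.2
    have hk := k.2
    rcases lt_or_gt_of_ne hkj with h | h
    · refine ⟨(-q ^ 2)⁻¹, ?_⟩
      rw [hX.mul_of_lt (a := (Fin.castLE (by omega) j : Fin N).rev)
        (b := (Fin.castLE (by omega) k : Fin N).rev), smul_smul,
        inv_mul_cancel₀ (neg_ne_zero.2 (pow_ne_zero 2 hq0)), one_smul]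
      · rw [Fin.rev_lt_rev]
        exact h
      · rw [Ne, Fin.ext_iff, Fin.rev_rev, Fin.val_rev, Fin.val_castLE, Fin.val_castLE]
        omega
    · refine ⟨-q ^ 2, hX.mul_of_lt ?_ ?_⟩
      · rw [Fin.rev_lt_rev]
        exact h
      · rw [Ne, Fin.ext_iff, Fin.rev_rev, Fin.val_rev, Fin.val_castLE, Fin.val_castLE]
        omega
  have hne : (Fin.castLE (by omega) j : Fin N).rev ≠ (Fin.castLE (by omega) j : Fin N).rev.rev := by
    have hj := j.2
    rw [Ne, Fin.ext_iff, Fin.rev_rev, Fin.val_rev, Fin.val_castLE]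
    omega
  unfold annihilatorProd
  induction L with
  | nil => simp at hj
  | cons k L ih =>
    rw [List.map_cons, List.prod_cons, ← mul_assoc]
    by_cases hkj : k = j
    · rw [hkj, hX.mul_self_eq_zero hq0 hq hne, zero_mul]
    · obtain ⟨t, ht⟩ := hex k hkj
      rw [ht, smul_mul_assoc, mul_assoc,
        ih ((List.mem_cons.1 hj).resolve_left (Ne.symm hkj)), mul_zero, smul_zero]

/-- The occupation `i` is left general for the induction: the leading annihilator, evaluated at `i`,
reads the rest of the product at `i` with one more mode filled. -/
theorem exists_annihilatorProd_fockGen_ne_zero (hq0 : q ≠ 0) (hq : ∀ m : ℕ, 0 < m → q ^ m ≠ 1)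
    (hc : c ≠ 0) (h2 : 2 * n ≤ N) {L : List (Fin n)} (hL : L.Nodup) (i : Fin n → Fin 2)
    (hi : ∀ k ∈ L, i k = 0) :
    ∃ f, annihilatorProd (by omega) (fockGen q c ν n : Fin N → _) L f i ≠ 0 := by
  have h1 : 1 + q ^ 2 ≠ 0 := by
    intro h
    apply hq 4 (by norm_num)
    linear_combination (q ^ 2 - 1) * h
  induction L generalizing i with
  | nil => exact ⟨fun _ => 1, by simp [annihilatorProd]⟩
  | cons k L ih =>
    rw [List.nodup_cons] at hL
    obtain ⟨f, hf⟩ := ih hL.2 (Function.update i k 1) fun l hl => by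
      rw [Function.update_of_ne, hi l (List.mem_cons_of_mem _ hl)]
      rintro rfl
      exact hL.1 hl
    refine ⟨f, ?_⟩
    unfold annihilatorProd at hf ⊢
    rw [List.map_cons, List.prod_cons, Module.End.mul_apply, fockGen_rev_castLE q c ν h2,
      LinearMap.smul_apply, Pi.smul_apply, ladder_apply, if_pos (hi k List.mem_cons_self), zero_add,
      smul_eq_mul]
    exact mul_ne_zero (mul_ne_zero (mul_ne_zero (pow_ne_zero 2 hc) h1) (pow_ne_zero _ hq0))
      (mul_ne_zero (signWeight_ne_zero hq0 _ _) hf)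

end Relations

/-! ### The left ideal generated by an arbitrary vacuum vector -/

section Ideal

variable {n N : ℕ} {q c ν : ℂ}

theorem Cl.induction {p : Cl q c N → Prop} (halg : ∀ r : ℂ, p (algebraMap ℂ _ r))
    (hγ : ∀ i, p (γ q c i)) (hadd : ∀ x y, p x → p y → p (x + y))
    (hmul : ∀ x y, p x → p y → p (x * y)) (x : Cl q c N) : p x := by
  obtain ⟨y, rfl⟩ := RingQuot.mkAlgHom_surjective ℂ (Rel q c N) x
  induction y using FreeAlgebra.induction with
  | grade0 r =>
    rw [AlgHom.commutes]
    exact halg r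
  | grade1 i => exact hγ i
  | mul a b ha hb =>
    rw [map_mul]
    exact hmul _ _ ha hb
  | add a b ha hb =>
    rw [map_add]
    exact hadd _ _ ha hb

variable (hq0 : q ≠ 0) (hq : ∀ m : ℕ, 0 < m → q ^ m ≠ 1) (hc : c ≠ 0) (h2 : 2 * n ≤ N)
  (h3 : N ≤ 2 * n + 1) (hN : 0 < N) {φ : Cl q c N} (hφ0 : φ ≠ 0)
  (hφ : ∀ k : Fin n, γ q c (Fin.castLE (by omega) k).rev * φ = 0)
  (hφm : N = 2 * n + 1 → ∀ a : Fin N, (a : ℕ) = n → γ q c a * φ = (ν * c) • φ)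
include hq0 hq h2 h3 hN hφ hφm

theorem mem_leftIdeal_iff_mem_range (x : Cl q c N) :
    x ∈ leftIdeal φ ↔ x ∈ LinearMap.range (fromFock (n := n) (by omega) (γ q c) φ) := by
  constructor
  · rw [mem_leftIdeal]
    rintro ⟨a, rfl⟩
    have hinv : ∀ a : Cl q c N, ∀ y ∈ LinearMap.range (fromFock (n := n) (by omega) (γ q c) φ),
        a * y ∈ LinearMap.range (fromFock (n := n) (by omega) (γ q c) φ) := by
      intro a
      induction a using Cl.induction with
      | halg r =>
        intro y hy
        rw [← Algebra.smul_def]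
        exact Submodule.smul_mem _ _ hy
      | hγ i =>
        rintro _ ⟨f, rfl⟩
        exact ⟨_, fromFock_fockGen (cliffordRel_γ hq0 hq hN) hq0 hq h2 h3 hφ hφm i f⟩
      | hadd a b ha hb =>
        intro y hy
        rw [add_mul]
        exact Submodule.add_mem _ (ha y hy) (hb y hy)
      | hmul a b ha hb =>
        intro y hy
        rw [mul_assoc]
        exact ha _ (hb y hy)
    refine hinv a φ ⟨Pi.single 0 1, ?_⟩
    rw [fromFock_single, listMonomial_finRange_zero, one_mul]
  · rintro ⟨f, rfl⟩
    rw [fromFock, Fintype.linearCombination_apply]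
    refine Submodule.sum_mem _ fun i _ => ?_
    rw [Algebra.smul_def]
    exact Ideal.mul_mem_left _ _ (Ideal.mul_mem_left _ _ (Ideal.subset_span rfl))

include hc

/-- Submodules of Fock space that come from left ideals contain the vacuum vector. -/
theorem vacuum_mem_of_fromFock_mem (J : Ideal (Cl q c N)) {f : (Fin n → Fin 2) → ℂ} (hf0 : f ≠ 0)
    (hf : fromFock (by omega) (γ q c) φ f ∈ J) : φ ∈ J := by
  have h1 : 1 + q ^ 2 ≠ 0 := by
    intro h
    apply hq 4 (by norm_num)
    linear_combination (q ^ 2 - 1) * h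
  have h := single_zero_mem (q := q) (f := f)
    (W := (J.restrictScalars ℂ).comap (fromFock (by omega) (γ q c) φ)) hq0 ?_ hf hf0
  · rw [Submodule.mem_comap, fromFock_single, listMonomial_finRange_zero, one_mul] at h
    exact h
  · intro j f hf
    have hr : c ^ 2 * (1 + q ^ 2) * q ^ (N - 2 * (j : ℕ) - 2) ≠ 0 :=
      mul_ne_zero (mul_ne_zero (pow_ne_zero 2 hc) h1) (pow_ne_zero _ hq0)
    rw [← Submodule.smul_mem_iff _ hr, ← LinearMap.smul_apply, ← fockGen_rev_castLE q c ν h2,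
      Submodule.mem_comap, fromFock_fockGen (cliffordRel_γ hq0 hq hN) hq0 hq h2 h3 hφ hφm]
    exact J.mul_mem_left _ hf

include hφ0

theorem fromFock_injective : Function.Injective (fromFock (n := n) (by omega) (γ q c) φ) := by
  rw [injective_iff_map_eq_zero]
  intro f hf
  by_contra hf0
  refine hφ0 ((Submodule.mem_bot (Cl q c N)).1 ?_)
  refine vacuum_mem_of_fromFock_mem hq0 hq hc h2 h3 hN hφ hφm ⊥ hf0 ?_
  rw [hf]
  exact Submodule.zero_mem _

theorem isAtom_leftIdeal : IsAtom (leftIdeal φ) := by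
  have hmem : φ ∈ leftIdeal φ := Ideal.subset_span rfl
  refine ⟨fun h => hφ0 ?_, fun J hJ => ?_⟩
  · rw [h] at hmem
    exact (Submodule.mem_bot _).1 hmem
  · by_contra hne
    obtain ⟨x, hxJ, hx0⟩ := Submodule.exists_mem_ne_zero_of_ne_bot hne
    obtain ⟨f, rfl⟩ :=
      (mem_leftIdeal_iff_mem_range hq0 hq h2 h3 hN hφ hφm x).1 (hJ.le hxJ)
    have hf0 : f ≠ 0 := by
      rintro rfl
      exact hx0 (map_zero _)
    have hφJ := vacuum_mem_of_fromFock_mem hq0 hq hc h2 h3 hN hφ hφm J hf0 hxJ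
    exact hJ.not_ge ((Ideal.span_singleton_le_iff_mem J).2 hφJ)

theorem exists_basis_leftIdeal : ∃ b : Module.Basis (Fin n → Fin 2) ℂ (leftIdeal φ),
    ∀ i, (b i : Cl q c N) = monomial q c (by omega) i * φ := by
  have hrange := mem_leftIdeal_iff_mem_range hq0 hq h2 h3 hN hφ hφm
  have hinj := fromFock_injective hq0 hq hc h2 h3 hN hφ0 hφ hφm
  let G : ((Fin n → Fin 2) → ℂ) →ₗ[ℂ] leftIdeal φ :=
    { toFun := fun f => ⟨fromFock (by omega) (γ q c) φ f, (hrange _).2 ⟨f, rfl⟩⟩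
      map_add' := fun f g => Subtype.ext (map_add _ f g)
      map_smul' := fun r f => Subtype.ext (map_smul _ r f) }
  have hG : Function.Bijective G := by
    refine ⟨fun f g h => hinj (congrArg Subtype.val h), fun x => ?_⟩
    obtain ⟨f, hf⟩ := (hrange _).1 x.2
    exact ⟨f, Subtype.ext hf⟩
  refine ⟨(Pi.basisFun ℂ (Fin n → Fin 2)).map (LinearEquiv.ofBijective G hG), fun i => ?_⟩
  rw [Module.Basis.map_apply, Pi.basisFun_apply, LinearEquiv.ofBijective_apply]
  change fromFock _ _ _ _ = _
  rw [fromFock_single, listMonomial, monomial, List.ofFn_eq_map]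

theorem isAtom_and_basis_and_finrank : IsAtom (leftIdeal φ) ∧
    (∃ b : Module.Basis (Fin n → Fin 2) ℂ (leftIdeal φ),
      ∀ i, (b i : Cl q c N) = monomial q c (by omega) i * φ) ∧
    Module.finrank ℂ (leftIdeal φ) = 2 ^ n := by
  refine ⟨isAtom_leftIdeal hq0 hq hc h2 h3 hN hφ0 hφ hφm,
    exists_basis_leftIdeal hq0 hq hc h2 h3 hN hφ0 hφ hφm, ?_⟩
  obtain ⟨b, -⟩ := exists_basis_leftIdeal hq0 hq hc h2 h3 hN hφ0 hφ hφm
  rw [Module.finrank_eq_card_basis b]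
  simp

end Ideal

/-! ### The elements `φ` are nonzero vacuum vectors -/

section Vacuum

variable {n N : ℕ} {q c : ℂ}

theorem le_two_mul_self (n : ℕ) : n ≤ 2 * n := by omega

theorem le_two_mul_add_one (n : ℕ) : n ≤ 2 * n + 1 := by omega

theorem nodup_map_rev_finRange (n : ℕ) : ((List.finRange n).map Fin.rev).Nodup :=
  (List.nodup_finRange n).map Fin.rev_injective

theorem mem_map_rev_finRange (k : Fin n) : k ∈ (List.finRange n).map Fin.rev :=
  List.mem_map.2 ⟨k.rev, List.mem_finRange _, Fin.rev_rev k⟩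

/-- Increasing labels `n + 1, …, 2n` are `n', …, 1'`, hence the reversed list of modes. -/
theorem phiEven_eq (q c : ℂ) (n : ℕ) : phiEven q c n
    = annihilatorProd (le_two_mul_self n) (γ q c) ((List.finRange n).map Fin.rev) := by
  rw [phiEven, annihilatorProd, List.ofFn_eq_map, List.map_map]
  congr 1
  refine List.map_congr_left fun k _ => congrArg (γ q c) (Fin.ext ?_)
  have hk := k.2
  rw [Fin.val_rev, Fin.val_castLE, Fin.val_rev]
  dsimp only
  omega

theorem phiOdd_eq (q c : ℂ) (n : ℕ) (ν : ℂ) : phiOdd q c n ν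
    = (algebraMap ℂ _ (ν * c) + γ q c (⟨n, by omega⟩ : Fin (2 * n + 1))) *
      annihilatorProd (le_two_mul_add_one n) (γ q c) ((List.finRange n).map Fin.rev) := by
  rw [phiOdd, annihilatorProd, List.ofFn_eq_map, List.map_map]
  congr 2
  refine List.map_congr_left fun k _ => congrArg (γ q c) (Fin.ext ?_)
  have hk := k.2
  rw [Fin.val_rev, Fin.val_castLE, Fin.val_rev]
  dsimp only
  omega

variable (hq0 : q ≠ 0) (hq : ∀ m : ℕ, 0 < m → q ^ m ≠ 1)
include hq0 hq

theorem rev_mul_phiEven (hn : 0 < n) (k : Fin n) :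
    γ q c (Fin.castLE (le_two_mul_self n) k).rev * phiEven q c n = 0 := by
  rw [phiEven_eq]
  exact (cliffordRel_γ hq0 hq (by omega)).rev_mul_annihilatorProd hq0 hq le_rfl
    (mem_map_rev_finRange k)

theorem phiEven_ne_zero (hc : c ≠ 0) (hn : 0 < n) : phiEven q c n ≠ 0 := by
  intro h
  obtain ⟨F, hF⟩ := exists_algHom hq0 hq (by omega) (cliffordRel_fockGen (c := c) (n := n)
    (N := 2 * n) hq0 hq (Or.inl rfl) le_rfl (by omega))
  obtain ⟨f, hf⟩ := exists_annihilatorProd_fockGen_ne_zero (ν := 1) hq0 hq hc (le_refl (2 * n))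
    (nodup_map_rev_finRange n) 0 fun _ _ => rfl
  apply hf
  have := congrArg F h
  rw [phiEven_eq, annihilatorProd, map_list_prod, List.map_map, map_zero] at this
  simp only [Function.comp_def, hF] at this
  unfold annihilatorProd
  rw [this]
  rfl

variable {ν : ℂ} (hν : ν = 1 ∨ ν = -1)

theorem rev_mul_phiOdd (k : Fin n) :
    γ q c (Fin.castLE (le_two_mul_add_one n) k).rev * phiOdd q c n ν = 0 := by
  have hk := k.2
  have hX := cliffordRel_γ (c := c) hq0 hq (show 0 < 2 * n + 1 by omega)
  have h0 := hX.rev_mul_annihilatorProd hq0 hq (Nat.le_succ (2 * n)) (mem_map_rev_finRange k)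
  rw [phiOdd_eq, ← mul_assoc, mul_add, ← Algebra.commutes, hX.mul_of_lt (a := ⟨n, by omega⟩),
    add_mul, mul_assoc, h0, smul_mul_assoc, mul_assoc, h0, mul_zero, mul_zero, smul_zero, add_zero]
  · rw [Fin.lt_def, Fin.val_rev, Fin.val_castLE]
    dsimp only
    omega
  · rw [Ne, Fin.rev_inj, Fin.ext_iff, Fin.val_castLE]
    dsimp only
    omega

include hν

/-- On the product of annihilators the middle generator squares to `c² = (ν c)²`, since the partial
form vanishes there. Thus `ν c + γ_{n+1}` projects, up to scale, onto the `ν c`-eigenspace. -/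
theorem middle_mul_phiOdd {a : Fin (2 * n + 1)} (ha : (a : ℕ) = n) :
    γ q c a * phiOdd q c n ν = (ν * c) • phiOdd q c n ν := by
  have hX := cliffordRel_γ (c := c) hq0 hq (show 0 < 2 * n + 1 by omega)
  have ha' : (⟨n, by omega⟩ : Fin (2 * n + 1)) = a := Fin.ext ha.symm
  have hP : partialForm q (γ q c) n *
      annihilatorProd (le_two_mul_add_one n) (γ q c : Fin (2 * n + 1) → _) ((List.finRange n).map Fin.rev)
        = 0 :=
    partialForm_mul_eq_zero (Nat.le_succ (2 * n)) le_rfl fun k _ =>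
      hX.rev_mul_annihilatorProd hq0 hq (Nat.le_succ (2 * n)) (mem_map_rev_finRange k)
  have hm := hX.middle_mul_self hq0 hq (rev_eq_self_of_val (n := n) rfl ha)
  rw [ha] at hm
  have hν2 : (ν * c) * (ν * c) = c ^ 2 := by
    rcases hν with rfl | rfl <;> ring
  rw [phiOdd_eq, ha', ← mul_assoc, mul_add, hm, ← Algebra.commutes, ← Algebra.smul_def, add_mul, add_mul,
    smul_mul_assoc, smul_mul_assoc, smul_mul_assoc, one_mul, hP, smul_zero, add_zero, add_mul,
    smul_add, ← Algebra.smul_def, smul_smul, hν2]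
  exact add_comm _ _

theorem phiOdd_ne_zero (hc : c ≠ 0) : phiOdd q c n ν ≠ 0 := by
  intro h
  obtain ⟨F, hF⟩ := exists_algHom hq0 hq (by omega) (cliffordRel_fockGen (c := c) (n := n)
    (N := 2 * n + 1) hq0 hq hν (by omega) le_rfl)
  obtain ⟨f, hf⟩ := exists_annihilatorProd_fockGen_ne_zero (ν := ν) hq0 hq hc
    (Nat.le_succ (2 * n)) (nodup_map_rev_finRange n) 0 fun _ _ => rfl
  have := congrArg F h
  rw [phiOdd_eq, map_mul, map_add, AlgHom.commutes, hF, annihilatorProd, map_list_prod,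
    List.map_map, map_zero] at this
  simp only [Function.comp_def, hF] at this
  have h0 := congrFun (LinearMap.congr_fun this f) 0
  rw [fockGen_middle q c ν rfl rfl, Module.End.mul_apply, LinearMap.add_apply, Pi.add_apply,
    diagOp_apply, Module.algebraMap_end_apply, Pi.smul_apply, smul_eq_mul, ← add_mul,
    LinearMap.zero_apply, Pi.zero_apply] at h0
  have hs : signWeight q n (0 : Fin n → Fin 2) = 1 := by simp [signWeight]
  have hν0 : ν ≠ 0 := by rcases hν with rfl | rfl <;> norm_num
  -- On the empty occupation the middle generator is `ν c`, so the first factor of `φ` acts as `2 ν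
  -- c ≠ 0`.
  rw [hs] at h0
  refine hf ((mul_eq_zero.1 h0).resolve_left ?_)
  rw [mul_one, ← two_mul]
  exact mul_ne_zero two_ne_zero (mul_ne_zero hν0 hc)

end Vacuum

end FRTClifford

end

open FRTClifford in
theorem mainTheorem7 (q c : ℂ) (hq0 : q ≠ 0) (hq : ∀ m : ℕ, 0 < m → q ^ m ≠ 1)
    (hc : ∃ r : ℝ, r ≠ 0 ∧ c ^ 2 = (r : ℂ)) :
    (∀ n : ℕ, 3 ≤ 2 * n →
      IsAtom (leftIdeal (phiEven q c n)) ∧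
      (∃ b : Module.Basis (Fin n → Fin 2) ℂ (leftIdeal (phiEven q c n)),
        ∀ i, (b i : Cl q c (2 * n)) = monomial q c (by omega) i * phiEven q c n) ∧
      Module.finrank ℂ (leftIdeal (phiEven q c n)) = 2 ^ n) ∧
    (∀ n : ℕ, 3 ≤ 2 * n + 1 → ∀ ν : ℂ, ν = 1 ∨ ν = -1 →
      IsAtom (leftIdeal (phiOdd q c n ν)) ∧
      (∃ b : Module.Basis (Fin n → Fin 2) ℂ (leftIdeal (phiOdd q c n ν)),
        ∀ i, (b i : Cl q c (2 * n + 1)) = monomial q c (by omega) i * phiOdd q c n ν) ∧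
      Module.finrank ℂ (leftIdeal (phiOdd q c n ν)) = 2 ^ n) := by
  have hc0 : c ≠ 0 := by
    rintro rfl
    obtain ⟨r, hr, h⟩ := hc
    apply hr
    have : (r : ℂ) = 0 := by rw [← h]; ring
    exact_mod_cast this
  refine ⟨fun n hn => ?_, fun n hn ν hν => ?_⟩
  · exact isAtom_and_basis_and_finrank (ν := 1) hq0 hq hc0 le_rfl (by omega) (by omega)
      (phiEven_ne_zero hq0 hq hc0 (by omega)) (rev_mul_phiEven hq0 hq (by omega))
      -- For even `N` there is no middle generator, so its eigenvalue condition is vacuous and the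
      -- choice `ν = 1` is immaterial.
      (fun h => absurd h (by omega))
  · exact isAtom_and_basis_and_finrank hq0 hq hc0 (by omega) le_rfl (by omega)
      (phiOdd_ne_zero hq0 hq hν hc0) (rev_mul_phiOdd hq0 hq)
      (fun _ _ ha => middle_mul_phiOdd hq0 hq hν ha)
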